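/- **Setting.** Let $\mathcal I=\{1,\dots,I\}$ (classes), $\mathcal J=\{1,\dots,J\}$ (server pools), and let $\mathcal E\subset\mathcal I\times\mathcal J$ be such that the bipartite graph $\mathcal G=(\mathcal I\cup\mathcal J,\mathcal E)$ is a tree. Write $\mathcal J(i)=\{j:(i,j)\in\mathcal E\}$, $\mathcal I(j)=\{i:(i,j)\in\mathcal E\}$, and $\mathbb R^{\mathcal G}$ for the set of $I\times J$ matrices that vanish off $\mathcal E$; $e$ is a vector of ones. For $n\ge1$ let $\lambda^n_i>0$, $\mu^n_{ij}>0$ ($(i,j)\in\mathcal E$) and integers $N^n_j>0$ be given such that, as $n\to\infty$, $\lambda^n_i/n\to\lambda_i>0$, $N^n_j/n\to\nu_j>0$, $\mu^n_{ij}\to\mu_{ij}>0$, and $$\hat\lambda^n_i:=\frac{\lambda^n_i-n\lambda_i}{\sqrt n}\to\hat\lambda_i,\qquad \hat\mu^n_{ij}:=\sqrt n(\mu^n_{ij}-\mu_{ij})\to\hat\mu_{ij},\qquad \hat\nu^n_j:=\sqrt n(n^{-1}N^n_j-\nu_j)\to\hat\nu_j .$$ Assume complete resource pooling: the linear program of minimizing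 $\max_j\sum_i\xi_{ij}$ over nonnegative $\xi\in\mathbb R^{\mathcal G}$ with $\sum_j\mu_{ij}\nu_j\xi_{ij}=\lambda_i$ for all $i$ has a unique solution $\xi^*$, and $\sum_i\xi^*_{ij}=1$ for all $j$ and $\xi^*_{ij}>0$ for all $(i,j)\in\mathcal E$. Put $z^*_{ij}=\xi^*_{ij}\nu_j$. Let $p\in\mathbb R^I$ be a probability vector with positive entries. **SWSS.** Let $(\vartheta_p,\kappa)\in\mathbb R\times\mathbb R^{\mathcal G}$ be the unique solution of the linear program: maximize $\vartheta$ subject to $\hat\lambda_i\le\sum_{j\in\mathcal J(i)}\mu_{ij}\kappa_{ij}-\vartheta p_i$ for all $i$ and $\sum_{i\in\mathcal I(j)}\kappa_{ij}=\hat\nu_j+\sum_{i\in\mathcal I(j)}\frac{\hat\mu_{ij}}{\mu_{ij}}z^*_{ij}$ for all $j$. For $n\ge1$ let $(\vartheta^n_p,\kappa^n)$ be the unique solution of the same program with $\hat\lambda^n,\mu^n,\hat\nu^n,\hat\mu^n$ in place of $\hat\lambda,\mu,\hat\nu,\hat\mu$ (and the same $z^*$, $p$). **Drift parameters.** Put $$h_i=\hat\lambda_i-\sum_{j\in\mathcal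 J(i)}\bigl(\mu_{ij}\xi^*_{ij}\hat\nu_j+\hat\mu_{ij}z^*_{ij}\bigr),\qquad h^n_i=\frac1{\sqrt n}\Bigl(\lambda^n_i-\sum_{j\in\mathcal J(i)}\mu^n_{ij}\xi^*_{ij}N^n_j\Bigr).$$ For $\alpha\in\mathbb R^I$, $\beta\in\mathbb R^J$ with $\langle e,\alpha\rangle=\langle e,\beta\rangle$ let $\Psi(\alpha,\beta)$ be the unique matrix in $\mathbb R^{\mathcal G}$ with row sums $\alpha$ and column sums $\beta$. Fix any pool $\hat\jmath$, and let $B_1\in\mathbb R^{I\times I}$, $B_2\in\mathbb R^{I\times J}$ be the unique matrices such that column $\hat\jmath$ of $B_2$ is zero and $$\sum_{j\in\mathcal J(i)}\mu_{ij}\Psi_{ij}(\alpha,\beta)=(B_1\alpha+B_2\beta)_i\qquad\text{for all } i \text{ and all } (\alpha,\beta) \text{ with } \langle e,\alpha\rangle=\langle e,\beta\rangle ;$$ let $B_1^n,B_2^n$ be defined likewise with $\mu^n$ in place of $\mu$. The drift of the limiting controlled diffusion, $b_i(x,(u^c,u^s))=h_i-\sum_{j\in\mathcal J(i)}\mu_{ij}\Psi_{ij}\bigl(x-\langle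 e,x\rangle^+u^c,-\langle e,x\rangle^-u^s\bigr)$, where $x\in\mathbb R^I$ and $u^c,u^s$ are probability vectors in $\mathbb R^I,\mathbb R^J$, is then $h-B_1(x-\langle e,x\rangle^+u^c)+\langle e,x\rangle^-B_2u^s$. **Theorem.** All the objects above are well defined, $B_1$ and $B_1^n$ are invertible with $\langle e,B_1^{-1}p\rangle>0$ and $\langle e,(B_1^n)^{-1}p\rangle>0$, and for every choice of $\hat\jmath$ and every $n\ge1$ $$\vartheta_p=-\frac{\langle e,B_1^{-1}h\rangle}{\langle e,B_1^{-1}p\rangle},\qquad \vartheta^n_p=-\frac{\langle e,(B_1^n)^{-1}h^n\rangle}{\langle e,(B_1^n)^{-1}p\rangle}.$$ Consequently the spare capacity $\varrho:=-\langle e,B_1^{-1}h\rangle$ satisfies $\varrho=\langle e,B_1^{-1}p\rangle\,\vartheta_p$. -/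

import Mathlib

open Filter Topology Matrix

noncomputable section

/-- The bipartite graph on the disjoint union of the classes and the server pools whose edges are
the pairs `(i, j)` in `E`. -/
def bipartiteGraph {I J : ℕ} (E : Finset (Fin I × Fin J)) : SimpleGraph (Fin I ⊕ Fin J) :=
  SimpleGraph.fromRel fun a b => ∃ i j, (i, j) ∈ E ∧ a = Sum.inl i ∧ b = Sum.inr j

/-- `poolsOf E i` is the set `𝒥(i)` of the pools that can serve class `i`. -/
def poolsOf {I J : ℕ} (E : Finset (Fin I × Fin J)) (i : Fin I) : Finset (Fin J) :=
  Finset.univ.filter fun j => (i, j) ∈ E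

/-- `classesOf E j` is the set `ℐ(j)` of the classes that can be served by pool `j`. -/
def classesOf {I J : ℕ} (E : Finset (Fin I × Fin J)) (j : Fin J) : Finset (Fin I) :=
  Finset.univ.filter fun i => (i, j) ∈ E

/-- Membership in `ℝ^𝒢`: the matrix vanishes off the edges. -/
def IsSupported {I J : ℕ} (E : Finset (Fin I × Fin J)) (ξ : Matrix (Fin I) (Fin J) ℝ) : Prop :=
  ∀ i j, (i, j) ∉ E → ξ i j = 0

/-- Feasible points of the fluid linear program. -/
structure IsFluidFeasible {I J : ℕ} (E : Finset (Fin I × Fin J)) (lam : Fin I → ℝ)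
    (μ : Matrix (Fin I) (Fin J) ℝ) (ν : Fin J → ℝ) (ξ : Matrix (Fin I) (Fin J) ℝ) : Prop where
  supported : IsSupported E ξ
  nonneg : ∀ i j, 0 ≤ ξ i j
  balance : ∀ i, ∑ j, μ i j * ν j * ξ i j = lam i

/-- Solutions of the fluid linear program: minimize `max_j ∑_i ξ i j` over the feasible points. -/
def IsFluidOptimal {I J : ℕ} (E : Finset (Fin I × Fin J)) (lam : Fin I → ℝ)
    (μ : Matrix (Fin I) (Fin J) ℝ) (ν : Fin J → ℝ) (ξ : Matrix (Fin I) (Fin J) ℝ) : Prop :=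
  IsFluidFeasible E lam μ ν ξ ∧
    ∀ ξ', IsFluidFeasible E lam μ ν ξ' → (⨆ j, ∑ i, ξ i j) ≤ ⨆ j, ∑ i, ξ' i j

/-- A sequence of multiclass multi-pool networks in the Halfin-Whitt regime, indexed by `n ≥ 1`,
on a tree and under complete resource pooling. Rates `μ i j` with `(i, j)` not an edge carry no
meaning and are never used. -/
structure NetworkSequence (I J : ℕ) where
  /-- the edges of the network graph -/
  E : Finset (Fin I × Fin J)
  tree : (bipartiteGraph E).IsTree
  /-- arrival rates of the `n`-th system -/
  lamN : ℕ → Fin I → ℝ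
  /-- service rates of the `n`-th system -/
  μN : ℕ → Matrix (Fin I) (Fin J) ℝ
  /-- numbers of servers of the `n`-th system -/
  N : ℕ → Fin J → ℕ
  lamN_pos : ∀ n, 1 ≤ n → ∀ i, 0 < lamN n i
  μN_pos : ∀ n, 1 ≤ n → ∀ i j, (i, j) ∈ E → 0 < μN n i j
  N_pos : ∀ n, 1 ≤ n → ∀ j, 0 < N n j
  /-- first-order limits -/
  lam : Fin I → ℝ
  μ : Matrix (Fin I) (Fin J) ℝ
  ν : Fin J → ℝ
  lam_pos : ∀ i, 0 < lam i
  μ_pos : ∀ i j, (i, j) ∈ E → 0 < μ i j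
  ν_pos : ∀ j, 0 < ν j
  tendsto_lam : ∀ i, Tendsto (fun n : ℕ => lamN n i / (n : ℝ)) atTop (𝓝 (lam i))
  tendsto_ν : ∀ j, Tendsto (fun n : ℕ => (N n j : ℝ) / (n : ℝ)) atTop (𝓝 (ν j))
  tendsto_μ : ∀ i j, (i, j) ∈ E → Tendsto (fun n : ℕ => μN n i j) atTop (𝓝 (μ i j))
  /-- second-order limits -/
  lamHat : Fin I → ℝ
  μHat : Matrix (Fin I) (Fin J) ℝ
  νHat : Fin J → ℝ
  tendsto_lamHat : ∀ i,
    Tendsto (fun n : ℕ => (lamN n i - (n : ℝ) * lam i) / √(n : ℝ)) atTop (𝓝 (lamHat i))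
  tendsto_μHat : ∀ i j, (i, j) ∈ E →
    Tendsto (fun n : ℕ => √(n : ℝ) * (μN n i j - μ i j)) atTop (𝓝 (μHat i j))
  tendsto_νHat : ∀ j,
    Tendsto (fun n : ℕ => √(n : ℝ) * ((n : ℝ)⁻¹ * (N n j : ℝ) - ν j)) atTop (𝓝 (νHat j))
  /-- complete resource pooling: `ξ` is the unique solution of the fluid linear program, it uses
  every pool fully, and it is positive on every edge -/
  ξ : Matrix (Fin I) (Fin J) ℝ
  ξ_optimal : IsFluidOptimal E lam μ ν ξ
  ξ_unique : ∀ ξ', IsFluidOptimal E lam μ ν ξ' → ξ' = ξ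
  ξ_full : ∀ j, ∑ i, ξ i j = 1
  ξ_pos : ∀ i j, (i, j) ∈ E → 0 < ξ i j

namespace NetworkSequence

variable {I J : ℕ} (S : NetworkSequence I J)

/-- The fluid-scale numbers `z*` of customers in service. -/
def z (i : Fin I) (j : Fin J) : ℝ := S.ξ i j * S.ν j

/-- `λ̂ⁿ` -/
def lamHatN (n : ℕ) (i : Fin I) : ℝ := (S.lamN n i - (n : ℝ) * S.lam i) / √(n : ℝ)

/-- `μ̂ⁿ` -/
def μHatN (n : ℕ) (i : Fin I) (j : Fin J) : ℝ := √(n : ℝ) * (S.μN n i j - S.μ i j)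

/-- `ν̂ⁿ` -/
def νHatN (n : ℕ) (j : Fin J) : ℝ := √(n : ℝ) * ((n : ℝ)⁻¹ * (S.N n j : ℝ) - S.ν j)

/-- `θ_j` -/
def θ (j : Fin J) : ℝ :=
  S.νHat j + ∑ i ∈ classesOf S.E j, S.μHat i j / S.μ i j * S.z i j

/-- `θⁿ_j` -/
def θN (n : ℕ) (j : Fin J) : ℝ :=
  S.νHatN n j + ∑ i ∈ classesOf S.E j, S.μHatN n i j / S.μN n i j * S.z i j

/-- The constant term `h` of the drift of the limiting diffusion. -/
def h (i : Fin I) : ℝ :=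
  S.lamHat i - ∑ j ∈ poolsOf S.E i, (S.μ i j * S.ξ i j * S.νHat j + S.μHat i j * S.z i j)

/-- The constant term `hⁿ` of the drift of the diffusion-scaled process of the `n`-th system. -/
def hN (n : ℕ) (i : Fin I) : ℝ :=
  1 / √(n : ℝ) * (S.lamN n i - ∑ j ∈ poolsOf S.E i, S.μN n i j * S.ξ i j * (S.N n j : ℝ))

end NetworkSequence

/-- Feasible points `(ϑ, κ)` of the second-order linear program. -/
structure IsStaffingFeasible {I J : ℕ} (E : Finset (Fin I × Fin J))
    (μ : Matrix (Fin I) (Fin J) ℝ) (lamHat : Fin I → ℝ) (θ : Fin J → ℝ) (p : Fin I → ℝ)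
    (ϑ : ℝ) (κ : Matrix (Fin I) (Fin J) ℝ) : Prop where
  supported : IsSupported E κ
  class_le : ∀ i, lamHat i ≤ ∑ j ∈ poolsOf E i, μ i j * κ i j - ϑ * p i
  pool_eq : ∀ j, ∑ i ∈ classesOf E j, κ i j = θ j

/-- Solutions `(ϑ, κ)` of the second-order linear program: `ϑ` is maximal. The SWSS is the
component `ϑ` of the solution. -/
def IsStaffingOptimal {I J : ℕ} (E : Finset (Fin I × Fin J))
    (μ : Matrix (Fin I) (Fin J) ℝ) (lamHat : Fin I → ℝ) (θ : Fin J → ℝ) (p : Fin I → ℝ)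
    (ϑ : ℝ) (κ : Matrix (Fin I) (Fin J) ℝ) : Prop :=
  IsStaffingFeasible E μ lamHat θ p ϑ κ ∧
    ∀ ϑ' κ', IsStaffingFeasible E μ lamHat θ p ϑ' κ' → ϑ' ≤ ϑ

/-- `ψ` is supported on the edges and has row sums `α` and column sums `β`. -/
structure IsTransport {I J : ℕ} (E : Finset (Fin I × Fin J)) (α : Fin I → ℝ) (β : Fin J → ℝ)
    (ψ : Matrix (Fin I) (Fin J) ℝ) : Prop where
  supported : IsSupported E ψ
  row_sum : ∀ i, ∑ j, ψ i j = α i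
  col_sum : ∀ j, ∑ i, ψ i j = β j

open Classical in
/-- The map `Ψ`, meaningful for `∑ α = ∑ β`: the matrix supported on the edges with row sums `α`
and column sums `β`. -/
def transport {I J : ℕ} (E : Finset (Fin I × Fin J)) (α : Fin I → ℝ) (β : Fin J → ℝ) :
    Matrix (Fin I) (Fin J) ℝ :=
  if hex : ∃ ψ, IsTransport E α β ψ then hex.choose else 0

/-- `B₁`, `B₂` are the matrices of the linear part of the drift for the service rates `μ`,
normalized so that the column of `B₂` that belongs to the pool `j₀` vanishes. -/
structure IsDriftPair {I J : ℕ} (E : Finset (Fin I × Fin J)) (μ : Matrix (Fin I) (Fin J) ℝ)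
    (j₀ : Fin J) (B₁ : Matrix (Fin I) (Fin I) ℝ) (B₂ : Matrix (Fin I) (Fin J) ℝ) : Prop where
  linear : ∀ (α : Fin I → ℝ) (β : Fin J → ℝ), ∑ i, α i = ∑ j, β j →
    ∀ i, ∑ j ∈ poolsOf E i, μ i j * transport E α β i j = (B₁ *ᵥ α + B₂ *ᵥ β) i
  column : ∀ i, B₂ i j₀ = 0

/-- The drift `b(x, (uᶜ, uˢ))` of the limiting controlled diffusion. -/
def NetworkSequence.drift {I J : ℕ} (S : NetworkSequence I J) (x uc : Fin I → ℝ)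
    (us : Fin J → ℝ) (i : Fin I) : ℝ :=
  S.h i - ∑ j ∈ poolsOf S.E i, S.μ i j *
    transport S.E (x - max (∑ k, x k) 0 • uc) (-(max (-∑ k, x k) 0 • us)) i j

/-- `⟨e, B₁⁻¹ v⟩` with `e` the vector of ones. -/
def totalInv {I : ℕ} (B₁ : Matrix (Fin I) (Fin I) ℝ) (v : Fin I → ℝ) : ℝ :=
  ∑ i, (B₁⁻¹ *ᵥ v) i

/-- The spare capacity `ϱ = -⟨e, B₁⁻¹ h⟩`. -/
def spareCapacity {I : ℕ} (B₁ : Matrix (Fin I) (Fin I) ℝ) (h : Fin I → ℝ) : ℝ :=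
  -totalInv B₁ h

end

/-! ### Matrices on a tree: cuts, transport, and balancing weights. -/

section Tree

variable {I J : ℕ} {E : Finset (Fin I × Fin J)}

/-! On a tree there are positive weights `y`, `w` with `y i * μ i j = w j` on every edge
(`exists_isBalancing`). They link the linear program to the drift matrix. They are dual multipliers:
weighting the class constraints by `y` eliminates `κ`, which gives `ϑ ≤ (⟨w, θ⟩ - ⟨y, lamHat⟩) / ⟨y,
p⟩`. The bound is attained with all class constraints tight, because a tree carries exactly one
supported matrix for each compatible pair of row and column sums. The same weights give `yᵀ B₁ = w
j₀ • eᵀ` (`IsDriftPair.sum_mul_mulVec`), so `totalInv B₁ v = ⟨y, v⟩ / w j₀`. The factor `w j₀`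
cancels in the quotient, whence the independence of `j₀`. It remains to check `⟨y, h⟩ = ⟨y, lamHat⟩
- ⟨w, θ⟩` in the limit (`sum_mul_h`) and, exactly, for each `n` (`sum_mul_hN`). -/

lemma bipartiteGraph_adj_inl_inr {i : Fin I} {j : Fin J} :
    (bipartiteGraph E).Adj (Sum.inl i) (Sum.inr j) ↔ (i, j) ∈ E := by
  simp [bipartiteGraph]

/-- In a tree every edge `(i₀, j₀)` is a cut: there is a two-valued function on the vertices that
jumps along this edge and along no other one. -/
lemma exists_cut (hT : (bipartiteGraph E).IsTree) {i₀ : Fin I} {j₀ : Fin J} (h₀ : (i₀, j₀) ∈ E) :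
    ∃ c : Fin I ⊕ Fin J → ℝ, ∀ i j, (i, j) ∈ E →
      c (Sum.inl i) - c (Sum.inr j) = if i = i₀ ∧ j = j₀ then 1 else 0 := by
  classical
  have hb := (SimpleGraph.isAcyclic_iff_forall_adj_isBridge.1 hT.isAcyclic)
    (bipartiteGraph_adj_inl_inr.2 h₀)
  rw [SimpleGraph.isBridge_iff] at hb
  set G' := (bipartiteGraph E).deleteEdges {s(Sum.inl i₀, Sum.inr j₀)} with hG'
  -- The indicator of the component of class `i₀` once the edge is removed; the edge is a bridge, so
  -- pool `j₀` lies outside it.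
  refine ⟨fun v => if G'.Reachable (Sum.inl i₀) v then 1 else 0, fun i j hij => ?_⟩
  by_cases he : i = i₀ ∧ j = j₀
  · obtain ⟨rfl, rfl⟩ := he
    simp [hb]
  · have hadj : G'.Adj (Sum.inl i) (Sum.inr j) := by
      rw [hG', SimpleGraph.deleteEdges_adj]
      exact ⟨bipartiteGraph_adj_inl_inr.2 hij, by simpa using he⟩
    have hiff : G'.Reachable (Sum.inl i₀) (Sum.inl i) ↔ G'.Reachable (Sum.inl i₀) (Sum.inr j) :=
      ⟨fun h => h.trans hadj.reachable, fun h => h.trans hadj.symm.reachable⟩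
    simp [he, hiff]

/-- A supported matrix on a tree with vanishing row and column sums vanishes. -/
lemma IsTransport.eq_zero (hT : (bipartiteGraph E).IsTree) {ψ : Matrix (Fin I) (Fin J) ℝ}
    (h : IsTransport E 0 0 ψ) : ψ = 0 := by
  ext i₀ j₀
  by_cases h₀ : (i₀, j₀) ∈ E
  · obtain ⟨c, hc⟩ := exists_cut hT h₀
    -- Pairing `ψ` with the jumps of `c` leaves only the entry at `(i₀, j₀)`, while vanishing row
    -- and column sums make the pairing zero.
    have e1 : ∑ i, ∑ j, ψ i j * c (Sum.inl i) = 0 := by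
      simp [← Finset.sum_mul, h.row_sum]
    have e2 : ∑ i, ∑ j, ψ i j * c (Sum.inr j) = 0 := by
      rw [Finset.sum_comm]
      simp [← Finset.sum_mul, h.col_sum]
    have e3 : ∀ i j, ψ i j * c (Sum.inl i) - ψ i j * c (Sum.inr j)
        = if i = i₀ then if j = j₀ then ψ i j else 0 else 0 := by
      intro i j
      by_cases hij : (i, j) ∈ E
      · rw [← mul_sub, hc i j hij]
        split_ifs <;> simp_all
      · simp [h.supported i j hij]
    have e4 : ∑ i, ∑ j, (ψ i j * c (Sum.inl i) - ψ i j * c (Sum.inr j)) = ψ i₀ j₀ := by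
      simp [e3]
    simp only [Finset.sum_sub_distrib, e1, e2, sub_zero] at e4
    simpa using e4.symm
  · exact h.supported _ _ h₀

lemma IsTransport.add {α α' : Fin I → ℝ} {β β' : Fin J → ℝ} {ψ ψ' : Matrix (Fin I) (Fin J) ℝ}
    (h : IsTransport E α β ψ) (h' : IsTransport E α' β' ψ') :
    IsTransport E (α + α') (β + β') (ψ + ψ') where
  supported i j hij := by simp [h.supported i j hij, h'.supported i j hij]
  row_sum i := by simp [Finset.sum_add_distrib, h.row_sum, h'.row_sum]
  col_sum j := by simp [Finset.sum_add_distrib, h.col_sum, h'.col_sum]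

lemma IsTransport.smul {α : Fin I → ℝ} {β : Fin J → ℝ} {ψ : Matrix (Fin I) (Fin J) ℝ}
    (h : IsTransport E α β ψ) (c : ℝ) : IsTransport E (c • α) (c • β) (c • ψ) where
  supported i j hij := by simp [h.supported i j hij]
  row_sum i := by simp [← Finset.mul_sum, h.row_sum]
  col_sum j := by simp [← Finset.mul_sum, h.col_sum]

lemma IsTransport.unique (hT : (bipartiteGraph E).IsTree) {α : Fin I → ℝ} {β : Fin J → ℝ}
    {ψ ψ' : Matrix (Fin I) (Fin J) ℝ} (h : IsTransport E α β ψ) (h' : IsTransport E α β ψ') :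
    ψ = ψ' := by
  have := (h.add (h'.smul (-1)))
  simp only [neg_smul, one_smul, add_neg_cancel] at this
  exact add_neg_eq_zero.1 (this.eq_zero hT)

/-- The imbalances of the vertices that can be met by a supported matrix. -/
def transportable (E : Finset (Fin I × Fin J)) : Submodule ℝ (Fin I ⊕ Fin J → ℝ) where
  carrier := {d | ∃ ψ, IsTransport E (fun i => d (Sum.inl i)) (fun j => -d (Sum.inr j)) ψ}
  add_mem' := by
    rintro d d' ⟨ψ, h⟩ ⟨ψ', h'⟩
    refine ⟨ψ + ψ', ?_⟩
    convert h.add h' using 1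
    · rfl
    · exact funext fun j => neg_add _ _
  zero_mem' := ⟨0, ⟨fun _ _ _ => rfl, by simp, by simp⟩⟩
  smul_mem' := by
    rintro c d ⟨ψ, h⟩
    refine ⟨c • ψ, ?_⟩
    convert h.smul c using 1
    · rfl
    · exact funext fun j => (mul_neg _ _).symm

/-- Along a walk the unit imbalances telescope, and each edge carries one unit in either direction.
-/
lemma single_sub_single_mem_transportable {u v : Fin I ⊕ Fin J}
    (h : (bipartiteGraph E).Reachable u v) :
    Pi.single u (1 : ℝ) - Pi.single v 1 ∈ transportable E := by
  have key : ∀ (i : Fin I) (j : Fin J), (i, j) ∈ E →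
      Pi.single (Sum.inl i) (1 : ℝ) - Pi.single (Sum.inr j) 1 ∈ transportable E := by
    intro i j hij
    refine ⟨Matrix.single i j 1, ⟨fun i' j' h => ?_, fun i' => ?_, fun j' => ?_⟩⟩
    · rw [Matrix.single_apply, if_neg]
      rintro ⟨rfl, rfl⟩
      exact h hij
    · simp [Matrix.single_apply, Pi.single_apply, ite_and, eq_comm]
    · simp [Matrix.single_apply, Pi.single_apply, ite_and, eq_comm]
  obtain ⟨w⟩ := h
  induction w with
  | nil => simp
  | @cons a b c hab _ ih =>
    have hmem : Pi.single a (1 : ℝ) - Pi.single b 1 ∈ transportable E := by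
      rw [bipartiteGraph, SimpleGraph.fromRel_adj] at hab
      obtain ⟨-, ⟨i, j, hij, rfl, rfl⟩ | ⟨i, j, hij, rfl, rfl⟩⟩ := hab
      · exact key i j hij
      · rw [← neg_sub]
        exact neg_mem (key i j hij)
    simpa using add_mem hmem ih

/-- An imbalance of total zero is a combination of unit transfers to a fixed root, and connectedness
provides each of these. -/
lemma exists_isTransport (hT : (bipartiteGraph E).IsTree) {α : Fin I → ℝ} {β : Fin J → ℝ}
    (h : ∑ i, α i = ∑ j, β j) : ∃ ψ, IsTransport E α β ψ := by
  obtain ⟨r⟩ := hT.1.nonempty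
  set d : Fin I ⊕ Fin J → ℝ := Sum.elim α (-β) with hd
  have hsum : ∑ v, d v = 0 := by simp [hd, h]
  have : d = ∑ v, d v • (Pi.single v (1 : ℝ) - Pi.single r 1) := by
    simp only [smul_sub, Finset.sum_sub_distrib, ← Finset.sum_smul, hsum, zero_smul, sub_zero]
    ext u
    simp [Finset.sum_apply, Pi.single_apply]
  have hmem : d ∈ transportable E := by
    rw [this]
    exact sum_mem fun v _ => Submodule.smul_mem _ _
      (single_sub_single_mem_transportable (hT.1.preconnected v r))
  obtain ⟨ψ, hψ⟩ := hmem
  exact ⟨ψ, by simpa [hd] using hψ⟩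

lemma isTransport_transport (hT : (bipartiteGraph E).IsTree) {α : Fin I → ℝ} {β : Fin J → ℝ}
    (h : ∑ i, α i = ∑ j, β j) : IsTransport E α β (transport E α β) := by
  have hex := exists_isTransport hT h
  rw [transport, dif_pos hex]
  exact hex.choose_spec

lemma isTransport_iff (hT : (bipartiteGraph E).IsTree) {α : Fin I → ℝ} {β : Fin J → ℝ}
    (h : ∑ i, α i = ∑ j, β j) (ψ : Matrix (Fin I) (Fin J) ℝ) :
    IsTransport E α β ψ ↔ ψ = transport E α β :=
  ⟨fun hψ => hψ.unique hT (isTransport_transport hT h), fun hψ => hψ ▸ isTransport_transport hT h⟩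

/-- Positive weights of classes and pools under which the service rates of a tree depend on the
pool only. -/
structure IsBalancing (E : Finset (Fin I × Fin J)) (μ : Matrix (Fin I) (Fin J) ℝ)
    (y : Fin I → ℝ) (w : Fin J → ℝ) : Prop where
  class_pos : ∀ i, 0 < y i
  pool_pos : ∀ j, 0 < w j
  mul_eq : ∀ i j, (i, j) ∈ E → y i * μ i j = w j

/-- In logarithms, `log w j - log y i = log (μ i j)` asks for a potential with prescribed increments
along the edges. On a tree the sum of the cut functions, weighted by these increments, is one. -/
lemma exists_isBalancing (hT : (bipartiteGraph E).IsTree) {μ : Matrix (Fin I) (Fin J) ℝ}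
    (hμ : ∀ i j, (i, j) ∈ E → 0 < μ i j) : ∃ y w, IsBalancing E μ y w := by
  choose c hc using fun e : E => exists_cut hT (i₀ := e.1.1) (j₀ := e.1.2) e.2
  let f : Fin I ⊕ Fin J → ℝ := fun v => -∑ e : E, Real.log (μ e.1.1 e.1.2) * c e v
  refine ⟨fun i => Real.exp (f (Sum.inl i)), fun j => Real.exp (f (Sum.inr j)),
    fun _ => Real.exp_pos _, fun _ => Real.exp_pos _, fun i j hij => ?_⟩
  have : f (Sum.inr j) - f (Sum.inl i) = Real.log (μ i j) := by
    have e1 : f (Sum.inr j) - f (Sum.inl i)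
        = ∑ e : E, Real.log (μ e.1.1 e.1.2) * (c e (Sum.inl i) - c e (Sum.inr j)) := by
      simp only [f, mul_sub, Finset.sum_sub_distrib]
      ring
    rw [e1, Finset.sum_eq_single ⟨(i, j), hij⟩]
    · simp [hc _ i j hij]
    · rintro ⟨⟨i', j'⟩, h'⟩ - hne
      rw [hc _ i j hij, if_neg, mul_zero]
      rintro ⟨rfl, rfl⟩
      exact hne rfl
    · simp
  rw [← Real.exp_log (hμ i j hij), ← Real.exp_add, ← this, add_sub_cancel]

end Tree

/-! ### The second-order linear program, solved by duality. -/

section LinearProgram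

variable {I J : ℕ} {E : Finset (Fin I × Fin J)} {μ : Matrix (Fin I) (Fin J) ℝ}
  {y : Fin I → ℝ} {w : Fin J → ℝ}

lemma sum_poolsOf_eq {i : Fin I} {f : Fin J → ℝ} (hf : ∀ j, (i, j) ∉ E → f j = 0) :
    ∑ j ∈ poolsOf E i, f j = ∑ j, f j :=
  Finset.sum_subset (Finset.subset_univ _) fun j _ hj => hf j (by simpa [poolsOf] using hj)

lemma sum_classesOf_eq {j : Fin J} {f : Fin I → ℝ} (hf : ∀ i, (i, j) ∉ E → f i = 0) :
    ∑ i ∈ classesOf E j, f i = ∑ i, f i :=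
  Finset.sum_subset (Finset.subset_univ _) fun i _ hi => hf i (by simpa [classesOf] using hi)

lemma mem_poolsOf {i : Fin I} {j : Fin J} : j ∈ poolsOf E i ↔ (i, j) ∈ E := by simp [poolsOf]

lemma mem_classesOf {i : Fin I} {j : Fin J} : i ∈ classesOf E j ↔ (i, j) ∈ E := by
  simp [classesOf]

lemma sum_poolsOf_comm (f : Fin I → Fin J → ℝ) :
    ∑ i, ∑ j ∈ poolsOf E i, f i j = ∑ j, ∑ i ∈ classesOf E j, f i j :=
  Finset.sum_comm' fun i j => by simp [mem_poolsOf, mem_classesOf]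

lemma IsBalancing.weighted_sum (hb : IsBalancing E μ y w) (κ : Fin I → Fin J → ℝ) :
    ∑ i, y i * ∑ j ∈ poolsOf E i, μ i j * κ i j = ∑ j, w j * ∑ i ∈ classesOf E j, κ i j := by
  simp only [Finset.mul_sum]
  rw [sum_poolsOf_comm]
  refine Finset.sum_congr rfl fun j _ => Finset.sum_congr rfl fun i hi => ?_
  rw [← mul_assoc, hb.mul_eq i j (mem_classesOf.1 hi)]

/-- Weighting the classes turns prescribed service rates and pool sums into row and column sums. -/
lemma IsBalancing.isTransport (hb : IsBalancing E μ y w) {κ : Matrix (Fin I) (Fin J) ℝ}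
    (hκ : IsSupported E κ) {r : Fin I → ℝ} {θ : Fin J → ℝ}
    (hr : ∀ i, ∑ j ∈ poolsOf E i, μ i j * κ i j = r i)
    (hθ : ∀ j, ∑ i ∈ classesOf E j, κ i j = θ j) :
    IsTransport E (fun i => y i * r i) (fun j => w j * θ j) (fun i j => w j * κ i j) where
  supported i j hij := by simp [hκ i j hij]
  row_sum i := by
    rw [← hr, Finset.mul_sum, ← sum_poolsOf_eq (E := E) fun j hij => by simp [hκ i j hij]]
    refine Finset.sum_congr rfl fun j hj => ?_
    rw [← mul_assoc, hb.mul_eq i j (mem_poolsOf.1 hj)]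
  col_sum j := by
    rw [← hθ, sum_classesOf_eq fun i hij => hκ i j hij, Finset.mul_sum]

lemma IsBalancing.unique (hT : (bipartiteGraph E).IsTree) (hb : IsBalancing E μ y w)
    {κ κ' : Matrix (Fin I) (Fin J) ℝ} (hκ : IsSupported E κ) (hκ' : IsSupported E κ')
    (hr : ∀ i, ∑ j ∈ poolsOf E i, μ i j * κ i j = ∑ j ∈ poolsOf E i, μ i j * κ' i j)
    (hθ : ∀ j, ∑ i ∈ classesOf E j, κ i j = ∑ i ∈ classesOf E j, κ' i j) : κ = κ' := by
  have := (hb.isTransport hκ hr hθ).unique hT (hb.isTransport hκ' (fun _ => rfl) fun _ => rfl)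
  ext i j
  exact mul_left_cancel₀ (hb.pool_pos j).ne' (congrFun (congrFun this i) j)

lemma IsBalancing.exists_matrix (hT : (bipartiteGraph E).IsTree) (hb : IsBalancing E μ y w)
    {r : Fin I → ℝ} {θ : Fin J → ℝ} (h : ∑ i, y i * r i = ∑ j, w j * θ j) :
    ∃ κ : Matrix (Fin I) (Fin J) ℝ, IsSupported E κ ∧
      (∀ i, ∑ j ∈ poolsOf E i, μ i j * κ i j = r i) ∧
      ∀ j, ∑ i ∈ classesOf E j, κ i j = θ j := by
  obtain ⟨ψ, hψ⟩ := exists_isTransport hT h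
  refine ⟨fun i j => ψ i j / w j, fun i j hij => by simp [hψ.supported i j hij],
    fun i => ?_, fun j => ?_⟩
  · apply mul_left_cancel₀ (hb.class_pos i).ne'
    rw [← hψ.row_sum, Finset.mul_sum, ← sum_poolsOf_eq fun j hij => hψ.supported i j hij]
    refine Finset.sum_congr rfl fun j hj => ?_
    rw [← mul_assoc, hb.mul_eq i j (mem_poolsOf.1 hj), mul_div_cancel₀ _ (hb.pool_pos j).ne']
  · rw [← Finset.sum_div, sum_classesOf_eq fun i hij => hψ.supported i j hij, hψ.col_sum,
      mul_div_cancel_left₀ _ (hb.pool_pos j).ne']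

variable {lamHat : Fin I → ℝ} {θ : Fin J → ℝ} {p : Fin I → ℝ} {ϑ : ℝ}
  {κ : Matrix (Fin I) (Fin J) ℝ}

/-- The total weighted slack of the class constraints depends on `ϑ` but not on `κ`; nonnegativity
of the slacks then yields weak duality. -/
lemma IsStaffingFeasible.slack (hf : IsStaffingFeasible E μ lamHat θ p ϑ κ)
    (hb : IsBalancing E μ y w) :
    ∑ i, y i * (∑ j ∈ poolsOf E i, μ i j * κ i j - ϑ * p i - lamHat i)
      = ∑ j, w j * θ j - ∑ i, y i * lamHat i - ϑ * ∑ i, y i * p i := by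
  have h1 := hb.weighted_sum κ
  have h2 : ∑ i, y i * (ϑ * p i) = ϑ * ∑ i, y i * p i := by
    simp only [Finset.mul_sum, mul_left_comm]
  simp only [hf.pool_eq] at h1
  simp only [mul_sub, Finset.sum_sub_distrib]
  rw [h1, h2]
  ring

lemma IsStaffingFeasible.le (hf : IsStaffingFeasible E μ lamHat θ p ϑ κ)
    (hb : IsBalancing E μ y w) (hp : 0 < ∑ i, y i * p i) :
    ϑ ≤ (∑ j, w j * θ j - ∑ i, y i * lamHat i) / ∑ i, y i * p i := by
  rw [le_div_iff₀ hp, ← sub_nonneg, ← hf.slack hb]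
  exact Finset.sum_nonneg fun i _ =>
    mul_nonneg (hb.class_pos i).le (sub_nonneg.2 (hf.class_le i))

/-- At this value the class constraints taken as equalities satisfy the one compatibility condition
of `IsBalancing.exists_matrix`. -/
lemma exists_isStaffingOptimal (hT : (bipartiteGraph E).IsTree) (hb : IsBalancing E μ y w)
    (hp : 0 < ∑ i, y i * p i) :
    ∃ κ, IsStaffingOptimal E μ lamHat θ p
      ((∑ j, w j * θ j - ∑ i, y i * lamHat i) / ∑ i, y i * p i) κ := by
  set ϑ := (∑ j, w j * θ j - ∑ i, y i * lamHat i) / ∑ i, y i * p i with hϑ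
  have : ∑ i, y i * (lamHat i + ϑ * p i) = ∑ j, w j * θ j := by
    have e : ∑ i, y i * (lamHat i + ϑ * p i)
        = ∑ i, y i * lamHat i + ϑ * ∑ i, y i * p i := by
      simp only [mul_add, Finset.sum_add_distrib, Finset.mul_sum, mul_left_comm]
    rw [e, hϑ, div_mul_cancel₀ _ hp.ne']
    ring
  obtain ⟨κ, hκ, hr, hθ⟩ := hb.exists_matrix hT this
  exact ⟨κ, ⟨hκ, fun i => by rw [hr]; linarith, hθ⟩, fun ϑ' κ' hf => hf.le hb hp⟩

lemma IsStaffingOptimal.value_eq (h : IsStaffingOptimal E μ lamHat θ p ϑ κ)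
    (hT : (bipartiteGraph E).IsTree) (hb : IsBalancing E μ y w) (hp : 0 < ∑ i, y i * p i) :
    ϑ = (∑ j, w j * θ j - ∑ i, y i * lamHat i) / ∑ i, y i * p i := by
  obtain ⟨κ', h'⟩ := exists_isStaffingOptimal (lamHat := lamHat) (θ := θ) hT hb hp
  exact le_antisymm (h.1.le hb hp) (h.2 _ _ h'.1)

/-- Complementary slackness: at the optimal value the weighted slacks sum to zero, and all weights
are positive. -/
lemma IsStaffingOptimal.class_eq (h : IsStaffingOptimal E μ lamHat θ p ϑ κ)
    (hT : (bipartiteGraph E).IsTree) (hb : IsBalancing E μ y w) (hp : 0 < ∑ i, y i * p i)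
    (i : Fin I) : ∑ j ∈ poolsOf E i, μ i j * κ i j = ϑ * p i + lamHat i := by
  have hs := h.1.slack hb
  have hz : ∑ j, w j * θ j - ∑ i, y i * lamHat i - ϑ * ∑ i, y i * p i = 0 := by
    rw [h.value_eq hT hb hp, div_mul_cancel₀ _ hp.ne', sub_self]
  rw [hz, Finset.sum_eq_zero_iff_of_nonneg fun i _ =>
    mul_nonneg (hb.class_pos i).le (sub_nonneg.2 (h.1.class_le i))] at hs
  have := (mul_eq_zero.1 (hs i (Finset.mem_univ i))).resolve_left (hb.class_pos i).ne'
  linarith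

lemma existsUnique_isStaffingOptimal (hT : (bipartiteGraph E).IsTree) (hb : IsBalancing E μ y w)
    (hp : 0 < ∑ i, y i * p i) :
    ∃! s : ℝ × Matrix (Fin I) (Fin J) ℝ, IsStaffingOptimal E μ lamHat θ p s.1 s.2 := by
  obtain ⟨κ, h⟩ := exists_isStaffingOptimal (lamHat := lamHat) (θ := θ) hT hb hp
  refine ⟨(_, κ), h, fun ⟨ϑ', κ'⟩ h' => ?_⟩
  have hϑ := h'.value_eq hT hb hp
  refine Prod.ext hϑ (hb.unique hT h'.1.supported h.1.supported (fun i => ?_) fun j => ?_)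
  · rw [h'.class_eq hT hb hp, h.class_eq hT hb hp, ← hϑ]
  · rw [h'.1.pool_eq, h.1.pool_eq]

end LinearProgram

/-! ### The drift matrices and the inverse of `B₁`. -/

section Drift

variable {I J : ℕ} {E : Finset (Fin I × Fin J)} {μ : Matrix (Fin I) (Fin J) ℝ} {j₀ : Fin J}
  {B₁ : Matrix (Fin I) (Fin I) ℝ} {B₂ : Matrix (Fin I) (Fin J) ℝ}

lemma IsDriftPair.mulVec_single (hB : IsDriftPair E μ j₀ B₁ B₂) (c : ℝ) :
    B₂ *ᵥ Pi.single j₀ c = 0 := by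
  ext i
  simp [hB.column]

/-- Putting all column mass on `j₀` silences `B₂`, so `B₁` is determined by transports into that
pool. -/
lemma IsDriftPair.mulVec_left (hB : IsDriftPair E μ j₀ B₁ B₂) (α : Fin I → ℝ) (i : Fin I) :
    (B₁ *ᵥ α) i = ∑ j ∈ poolsOf E i, μ i j * transport E α (Pi.single j₀ (∑ i, α i)) i j := by
  rw [hB.linear _ _ (by simp), hB.mulVec_single, add_zero]

lemma IsDriftPair.mulVec_right (hB : IsDriftPair E μ j₀ B₁ B₂) (l : Fin J) (i : Fin I) :
    B₂ i l = ∑ j ∈ poolsOf E i,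
      μ i j * transport E 0 (Pi.single l 1 - Pi.single j₀ 1) i j := by
  rw [hB.linear _ _ (by simp), mulVec_sub, hB.mulVec_single]
  simp

lemma IsDriftPair.unique {B₁' : Matrix (Fin I) (Fin I) ℝ} {B₂' : Matrix (Fin I) (Fin J) ℝ}
    (hB : IsDriftPair E μ j₀ B₁ B₂) (hB' : IsDriftPair E μ j₀ B₁' B₂') :
    B₁ = B₁' ∧ B₂ = B₂' := by
  constructor
  · ext i k
    have := (hB.mulVec_left (Pi.single k 1) i).trans (hB'.mulVec_left (Pi.single k 1) i).symm
    simpa using this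
  · ext i l
    rw [hB.mulVec_right, hB'.mulVec_right]

/-- By uniqueness it suffices to compare margins; the surplus at `j₀` is `∑ α - ∑ β`, hence zero. -/
lemma transport_eq_sum (hT : (bipartiteGraph E).IsTree) {α : Fin I → ℝ} {β : Fin J → ℝ}
    (h : ∑ i, α i = ∑ j, β j) (j₀ : Fin J) :
    transport E α β = ∑ k, α k • transport E (Pi.single k 1) (Pi.single j₀ 1)
      + ∑ l, β l • transport E 0 (Pi.single l 1 - Pi.single j₀ 1) := by
  have h1 k := isTransport_transport hT (α := Pi.single k 1) (β := Pi.single j₀ 1) (by simp)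
  have h2 l := isTransport_transport hT (α := 0) (β := Pi.single l 1 - Pi.single j₀ 1) (by simp)
  refine ((isTransport_iff hT h _).1 ⟨fun i j hij => ?_, fun i => ?_, fun j => ?_⟩).symm
  · simp [Matrix.sum_apply, (h1 _).supported i j hij, (h2 _).supported i j hij]
  · simp only [Matrix.add_apply, Matrix.sum_apply, Matrix.smul_apply, Finset.sum_add_distrib]
    rw [Finset.sum_comm, Finset.sum_comm (γ := Fin J)]
    simp [← Finset.mul_sum, (h1 _).row_sum, (h2 _).row_sum, Pi.single_apply]
  · simp only [Matrix.add_apply, Matrix.sum_apply, Matrix.smul_apply, Finset.sum_add_distrib]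
    rw [Finset.sum_comm, Finset.sum_comm (γ := Fin I) (α := Fin J)]
    simp only [smul_eq_mul, ← Finset.mul_sum, (h1 _).col_sum, (h2 _).col_sum, Pi.sub_apply,
      mul_sub, Finset.sum_sub_distrib, ← Finset.sum_mul, h]
    simp [Pi.single_apply]

lemma exists_isDriftPair (hT : (bipartiteGraph E).IsTree) (μ : Matrix (Fin I) (Fin J) ℝ)
    (j₀ : Fin J) : ∃ B₁ B₂, IsDriftPair E μ j₀ B₁ B₂ := by
  refine ⟨fun i k => ∑ j ∈ poolsOf E i,
      μ i j * transport E (Pi.single k 1) (Pi.single j₀ 1) i j,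
    fun i l => ∑ j ∈ poolsOf E i,
      μ i j * transport E 0 (Pi.single l 1 - Pi.single j₀ 1) i j,
    fun α β h i => ?_, fun i => ?_⟩
  · rw [transport_eq_sum hT h j₀]
    simp only [Matrix.add_apply, Matrix.sum_apply, Matrix.smul_apply, Pi.add_apply, mulVec,
      dotProduct, Finset.mul_sum, Finset.sum_mul, mul_add, Finset.sum_add_distrib, smul_eq_mul]
    congr 1 <;>
    · rw [Finset.sum_comm]
      exact Finset.sum_congr rfl fun _ _ => Finset.sum_congr rfl fun _ _ => by ring
  -- For `l = j₀` the column margin `Pi.single l 1 - Pi.single j₀ 1` is zero.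
  · have : transport E (0 : Fin I → ℝ) (0 : Fin J → ℝ) = 0 :=
      (isTransport_transport hT (by simp)).eq_zero hT
    simp [this]

lemma existsUnique_isDriftPair (hT : (bipartiteGraph E).IsTree) (μ : Matrix (Fin I) (Fin J) ℝ)
    (j₀ : Fin J) :
    ∃! B : Matrix (Fin I) (Fin I) ℝ × Matrix (Fin I) (Fin J) ℝ, IsDriftPair E μ j₀ B.1 B.2 := by
  obtain ⟨B₁, B₂, h⟩ := exists_isDriftPair hT μ j₀
  exact ⟨(B₁, B₂), h, fun B hB => Prod.ext (hB.unique h).1 (hB.unique h).2⟩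

variable {y : Fin I → ℝ} {w : Fin J → ℝ}

/-- The weights of the classes form a row vector that `B₁` maps to a multiple of `e`. -/
lemma IsDriftPair.sum_mul_mulVec (hB : IsDriftPair E μ j₀ B₁ B₂)
    (hT : (bipartiteGraph E).IsTree) (hb : IsBalancing E μ y w) (α : Fin I → ℝ) :
    ∑ i, y i * (B₁ *ᵥ α) i = w j₀ * ∑ i, α i := by
  have ht := isTransport_transport hT (α := α) (β := Pi.single j₀ (∑ i, α i)) (by simp)
  simp only [hB.mulVec_left]
  refine (hb.weighted_sum (transport E α (Pi.single j₀ (∑ i, α i)))).trans ?_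
  simp only [sum_classesOf_eq fun i hij => ht.supported i _ hij, ht.col_sum]
  simp [Pi.single_apply]

/-- A kernel vector `α` has sum zero because `yᵀ B₁` is a nonzero multiple of `eᵀ`. Its transport
against `β = 0` then has zero service rates and zero pool sums, so it vanishes, and `α`, its row
sums, with it. -/
lemma IsDriftPair.isUnit_det (hB : IsDriftPair E μ j₀ B₁ B₂)
    (hT : (bipartiteGraph E).IsTree) (hb : IsBalancing E μ y w) : IsUnit B₁.det := by
  rw [isUnit_iff_ne_zero]
  intro hdet
  obtain ⟨α, hne, hα⟩ := Matrix.exists_mulVec_eq_zero_iff.2 hdet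
  apply hne
  have hsum : ∑ i, α i = 0 := by
    have := hB.sum_mul_mulVec hT hb α
    simpa [hα, (hb.pool_pos j₀).ne'] using this.symm
  have ht := isTransport_transport hT (α := α) (β := 0) (by simp [hsum])
  have h0 : transport E α 0 = 0 := by
    refine hb.unique hT ht.supported (fun _ _ _ => rfl) (fun i => ?_) fun j => ?_
    · have := hB.mulVec_left α i
      rw [hsum, Pi.single_zero, hα] at this
      simpa using this.symm
    · rw [sum_classesOf_eq fun i hij => ht.supported i j hij, ht.col_sum]
      simp
  ext i
  rw [← ht.row_sum, h0]
  simp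

lemma IsDriftPair.totalInv_eq (hB : IsDriftPair E μ j₀ B₁ B₂)
    (hT : (bipartiteGraph E).IsTree) (hb : IsBalancing E μ y w) (v : Fin I → ℝ) :
    totalInv B₁ v = (∑ i, y i * v i) / w j₀ := by
  have := hB.sum_mul_mulVec hT hb (B₁⁻¹ *ᵥ v)
  rw [mulVec_mulVec, mul_nonsing_inv _ (hB.isUnit_det hT hb), one_mulVec] at this
  rw [this, mul_div_cancel_left₀ _ (hb.pool_pos j₀).ne', totalInv]

lemma IsStaffingOptimal.eq_neg_totalInv_div {lamHat p h : Fin I → ℝ} {θ : Fin J → ℝ} {ϑ : ℝ}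
    {κ : Matrix (Fin I) (Fin J) ℝ} (hs : IsStaffingOptimal E μ lamHat θ p ϑ κ)
    (hB : IsDriftPair E μ j₀ B₁ B₂) (hT : (bipartiteGraph E).IsTree) (hb : IsBalancing E μ y w)
    (hp : 0 < ∑ i, y i * p i) (hh : ∑ i, y i * h i = ∑ i, y i * lamHat i - ∑ j, w j * θ j) :
    ϑ = -(totalInv B₁ h / totalInv B₁ p) := by
  rw [hs.value_eq hT hb hp, hB.totalInv_eq hT hb, hB.totalInv_eq hT hb, hh,
    div_div_div_cancel_right₀ (hb.pool_pos j₀).ne', ← neg_div, neg_sub]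

end Drift

/-! ### The weighted constant terms of the drift, and the theorem. -/

namespace NetworkSequence

variable {I J : ℕ} (S : NetworkSequence I J) {y : Fin I → ℝ} {w : Fin J → ℝ}

lemma sum_classesOf_ξ (j : Fin J) : ∑ i ∈ classesOf S.E j, S.ξ i j = 1 := by
  rw [sum_classesOf_eq fun i hij => S.ξ_optimal.1.supported i j hij, S.ξ_full]

lemma sum_poolsOf_z (i : Fin I) : ∑ j ∈ poolsOf S.E i, S.μ i j * S.z i j = S.lam i := by
  rw [sum_poolsOf_eq fun j hij => by simp [z, S.ξ_optimal.1.supported i j hij],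
    ← S.ξ_optimal.1.balance]
  exact Finset.sum_congr rfl fun j _ => by rw [z]; ring

lemma sum_mul_h (hb : IsBalancing S.E S.μ y w) :
    ∑ i, y i * S.h i = ∑ i, y i * S.lamHat i - ∑ j, w j * S.θ j := by
  -- Factoring out `μ i j` exposes the summands of `θ j`, weighted by `ξ` where needed, so that `y`
  -- can be traded for `w`.
  have e (i : Fin I) : ∑ j ∈ poolsOf S.E i, (S.μ i j * S.ξ i j * S.νHat j + S.μHat i j * S.z i j)
      = ∑ j ∈ poolsOf S.E i,
        S.μ i j * (S.ξ i j * S.νHat j + S.μHat i j / S.μ i j * S.z i j) := by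
    refine Finset.sum_congr rfl fun j hj => ?_
    have := (S.μ_pos i j (mem_poolsOf.1 hj)).ne'
    field_simp
  simp only [h, e, mul_sub, Finset.sum_sub_distrib]
  rw [hb.weighted_sum]
  simp only [Finset.sum_add_distrib, ← Finset.sum_mul, S.sum_classesOf_ξ, one_mul, θ]

/-- Both sides equal `(⟨y, lamN n⟩ - ⟨w, N n⟩) / √n`. The centering terms of order `√n` in `lamHatN`
and `θN` cancel by the fluid balance `∑ j, μ i j * z i j = lam i`. Dividing by `μN` rather than `μ`
in `θN` makes this exact, since `w j / μN n i j = y i`. -/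
lemma sum_mul_hN {n : ℕ} (hn : 1 ≤ n) (hb : IsBalancing S.E (S.μN n) y w) :
    ∑ i, y i * S.hN n i = ∑ i, y i * S.lamHatN n i - ∑ j, w j * S.θN n j := by
  have hn0 : (0 : ℝ) < n := by exact_mod_cast hn
  have hs : √(n : ℝ) ≠ 0 := (Real.sqrt_pos.2 hn0).ne'
  have hsq : √(n : ℝ) * √(n : ℝ) = n := Real.mul_self_sqrt hn0.le
  have e1 (i : Fin I) : y i * S.hN n i = 1 / √(n : ℝ) * (y i * S.lamN n i)
      - 1 / √(n : ℝ) * (y i * ∑ j ∈ poolsOf S.E i, S.μN n i j * (S.ξ i j * S.N n j)) := by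
    simp only [hN, ← mul_assoc]
    ring
  have e2 (i : Fin I) : y i * S.lamHatN n i = 1 / √(n : ℝ) * (y i * S.lamN n i)
      - √(n : ℝ) * (y i * S.lam i) := by
    have : S.lamHatN n i = 1 / √(n : ℝ) * S.lamN n i - √(n : ℝ) * S.lam i := by
      rw [lamHatN, div_eq_iff hs, sub_mul, mul_right_comm, one_div, inv_mul_cancel₀ hs, one_mul,
        mul_right_comm, hsq]
    rw [this]
    ring
  have e3 (j : Fin J) : w j * S.θN n j = 1 / √(n : ℝ) * (w j * S.N n j)
      - √(n : ℝ) * ∑ i ∈ classesOf S.E j, y i * (S.μ i j * S.z i j) := by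
    have e4 : ∑ i ∈ classesOf S.E j, S.μHatN n i j / S.μN n i j * S.z i j
        = √(n : ℝ) * S.ν j
          - √(n : ℝ) * ∑ i ∈ classesOf S.E j, S.μ i j / S.μN n i j * S.z i j := by
      have : S.ν j = ∑ i ∈ classesOf S.E j, S.z i j := by
        simp only [z, ← Finset.sum_mul, S.sum_classesOf_ξ, one_mul]
      rw [this, ← mul_sub, ← Finset.sum_sub_distrib, Finset.mul_sum]
      refine Finset.sum_congr rfl fun i hi => ?_
      have := (S.μN_pos n hn i j (mem_classesOf.1 hi)).ne'
      rw [μHatN]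
      field_simp
    have e5 : ∑ i ∈ classesOf S.E j, y i * (S.μ i j * S.z i j)
        = w j * ∑ i ∈ classesOf S.E j, S.μ i j / S.μN n i j * S.z i j := by
      rw [Finset.mul_sum]
      refine Finset.sum_congr rfl fun i hi => ?_
      have := (S.μN_pos n hn i j (mem_classesOf.1 hi)).ne'
      rw [← hb.mul_eq i j (mem_classesOf.1 hi)]
      field_simp
    have e6 : √(n : ℝ) * (n : ℝ)⁻¹ = 1 / √(n : ℝ) := by
      rw [eq_div_iff hs, mul_right_comm, hsq, mul_inv_cancel₀ hn0.ne']
    rw [e5, θN, νHatN, e4, mul_sub, ← mul_assoc, e6]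
    ring
  simp only [e1, e2, e3, Finset.sum_sub_distrib, ← Finset.mul_sum]
  rw [hb.weighted_sum, ← sum_poolsOf_comm]
  simp only [← Finset.mul_sum, S.sum_poolsOf_z, ← Finset.sum_mul, S.sum_classesOf_ξ, one_mul]
  ring

lemma drift_eq {j₀ : Fin J} {B₁ : Matrix (Fin I) (Fin I) ℝ} {B₂ : Matrix (Fin I) (Fin J) ℝ}
    (hB : IsDriftPair S.E S.μ j₀ B₁ B₂) (x : Fin I → ℝ) {uc : Fin I → ℝ}
    (huc : ∑ i, uc i = 1) {us : Fin J → ℝ} (hus : ∑ j, us j = 1) :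
    S.drift x uc us = S.h - B₁ *ᵥ (x - max (∑ k, x k) 0 • uc)
      + max (-∑ k, x k) 0 • (B₂ *ᵥ us) := by
  ext i
  rw [drift, hB.linear, mulVec_neg, mulVec_smul]
  · simp only [Pi.add_apply, Pi.sub_apply, Pi.neg_apply, Pi.smul_apply]
    ring
  · simp only [Pi.sub_apply, Pi.neg_apply, Pi.smul_apply, smul_eq_mul, Finset.sum_sub_distrib,
      Finset.sum_neg_distrib, ← Finset.mul_sum, huc, hus, mul_one]
    -- The two arguments of `transport` have equal totals because `s - s⁺ = -s⁻`.
    rcases le_total (∑ k, x k) 0 with h | h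
    · rw [max_eq_right h, max_eq_left (neg_nonneg.2 h)]
      ring
    · rw [max_eq_left h, max_eq_right (neg_nonpos.2 h)]
      ring

end NetworkSequence

theorem theorem4 {I J : ℕ} (S : NetworkSequence I J) (p : Fin I → ℝ)
    (hp : p ∈ stdSimplex ℝ (Fin I)) (hpos : ∀ i, 0 < p i) :
    -- the map `Ψ` is well defined on `{∑ α = ∑ β}`
    (∀ (α : Fin I → ℝ) (β : Fin J → ℝ), ∑ i, α i = ∑ j, β j →
      ∀ ψ, IsTransport S.E α β ψ ↔ ψ = transport S.E α β) ∧
    -- both linear programs have a unique solution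
    (∃! s : ℝ × Matrix (Fin I) (Fin J) ℝ,
      IsStaffingOptimal S.E S.μ S.lamHat S.θ p s.1 s.2) ∧
    (∀ n, 1 ≤ n → ∃! s : ℝ × Matrix (Fin I) (Fin J) ℝ,
      IsStaffingOptimal S.E (S.μN n) (S.lamHatN n) (S.θN n) p s.1 s.2) ∧
    -- the limiting diffusion
    (∀ j₀ : Fin J,
      (∃! B : Matrix (Fin I) (Fin I) ℝ × Matrix (Fin I) (Fin J) ℝ,
        IsDriftPair S.E S.μ j₀ B.1 B.2) ∧
      ∀ B₁ B₂, IsDriftPair S.E S.μ j₀ B₁ B₂ →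
        (∀ (x : Fin I → ℝ), ∀ uc ∈ stdSimplex ℝ (Fin I), ∀ us ∈ stdSimplex ℝ (Fin J),
          S.drift x uc us = S.h - B₁ *ᵥ (x - max (∑ k, x k) 0 • uc)
            + max (-∑ k, x k) 0 • (B₂ *ᵥ us)) ∧
        IsUnit B₁.det ∧
        0 < totalInv B₁ p ∧
        ∀ ϑ κ, IsStaffingOptimal S.E S.μ S.lamHat S.θ p ϑ κ →
          ϑ = -(totalInv B₁ S.h / totalInv B₁ p) ∧
          spareCapacity B₁ S.h = totalInv B₁ p * ϑ) ∧
    -- the `n`-th system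
    (∀ n, 1 ≤ n → ∀ j₀ : Fin J,
      (∃! B : Matrix (Fin I) (Fin I) ℝ × Matrix (Fin I) (Fin J) ℝ,
        IsDriftPair S.E (S.μN n) j₀ B.1 B.2) ∧
      ∀ B₁ B₂, IsDriftPair S.E (S.μN n) j₀ B₁ B₂ →
        IsUnit B₁.det ∧
        0 < totalInv B₁ p ∧
        ∀ ϑ κ, IsStaffingOptimal S.E (S.μN n) (S.lamHatN n) (S.θN n) p ϑ κ →
          ϑ = -(totalInv B₁ (S.hN n) / totalInv B₁ p)) := by
  have hT := S.tree
  obtain ⟨y, w, hb⟩ := exists_isBalancing hT S.μ_pos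
  have hbN (n : ℕ) (hn : 1 ≤ n) := exists_isBalancing hT (S.μN_pos n hn)
  -- A probability vector needs at least one class; this makes `⟨y, p⟩` strictly positive.
  have hne : (Finset.univ : Finset (Fin I)).Nonempty := by
    refine Finset.nonempty_of_sum_ne_zero (f := p) ?_
    rw [hp.2]
    exact one_ne_zero
  have hyp {y : Fin I → ℝ} (hy : ∀ i, 0 < y i) : 0 < ∑ i, y i * p i :=
    Finset.sum_pos (fun i _ => mul_pos (hy i) (hpos i)) hne
  refine ⟨fun α β h ψ => isTransport_iff hT h ψ,
    existsUnique_isStaffingOptimal hT hb (hyp hb.class_pos), fun n hn => ?_,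
    fun j₀ => ⟨existsUnique_isDriftPair hT _ j₀, fun B₁ B₂ hB => ?_⟩,
    fun n hn j₀ => ⟨existsUnique_isDriftPair hT _ j₀, fun B₁ B₂ hB => ?_⟩⟩
  · obtain ⟨y, w, hb⟩ := hbN n hn
    exact existsUnique_isStaffingOptimal hT hb (hyp hb.class_pos)
  · have htp : 0 < totalInv B₁ p := by
      rw [hB.totalInv_eq hT hb]
      exact div_pos (hyp hb.class_pos) (hb.pool_pos j₀)
    refine ⟨fun x uc huc us hus => S.drift_eq hB x huc.2 hus.2, hB.isUnit_det hT hb, htp,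
      fun ϑ κ hs => ?_⟩
    have hϑ := hs.eq_neg_totalInv_div hB hT hb (hyp hb.class_pos) (S.sum_mul_h hb)
    refine ⟨hϑ, ?_⟩
    rw [hϑ, spareCapacity, mul_neg, mul_div_cancel₀ _ htp.ne']
  · obtain ⟨y, w, hb⟩ := hbN n hn
    refine ⟨hB.isUnit_det hT hb, ?_, fun ϑ κ hs =>
      hs.eq_neg_totalInv_div hB hT hb (hyp hb.class_pos) (S.sum_mul_hN hn hb)⟩
    rw [hB.totalInv_eq hT hb]
    exact div_pos (hyp hb.class_pos) (hb.pool_pos j₀)
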